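/- Conventions. For $b\in\mathbb R$ and a Lévy measure $\nu$ on $\mathbb R$ (a positive Borel measure with $\nu(\{0\})=0$ and $\int\min(1,u^2)\,\nu(du)<\infty$), $X\sim ID(b,0,\nu)$ means that $X$ has characteristic function $$\varphi(t)=\exp\Big(itb+\int_{\mathbb R}\big(e^{itu}-1-itu\mathbf 1_{|u|\le 1}\big)\nu(du)\Big),\qquad t\in\mathbb R.$$ If moreover $\int_{-1}^1|u|\,\nu(du)<\infty$ and $\mathbb E|X|<\infty$, put $b_0=b-\int_{-1}^1u\,\nu(du)$, $b_0^\pm=\max(\pm b_0,0)$, $\tilde\nu_+(du)=u\mathbf 1_{(0,\infty)}(u)\nu(du)$, $\tilde\nu_-(du)=(-u)\mathbf 1_{(-\infty,0)}(u)\nu(du)$, and $$m_0^\pm=b_0^\pm+\tilde\nu_\pm(\mathbb R).$$ When $m_0^\pm\neq 0$, $Y^\pm$ denotes a random variable with law $\frac{b_0^\pm}{m_0^\pm}\delta_0+\frac{1}{m_0^\pm}\tilde\nu_\pm$; when $m_0^\pm=0$, $Y^\pm$ may be taken to be any random variable. The Kolmogorov distance is $d_K(X,Z)=\sup_{x\in\mathbb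 R}|\mathbb P(X\le x)-\mathbb P(Z\le x)|$. Theorem. Let $X_n\sim ID(b_n,0,\nu_n)$, $n\ge1$, be nondegenerate random variables converging in law to a nondegenerate $X_\infty\sim ID(b_\infty,0,\nu_\infty)$, with $\mathbb E|X_n|<\infty$, $\mathbb E|X_\infty|<\infty$, $\int_{-1}^1|u|\,\nu_n(du)<\infty$ for all $n$ and $\int_{-1}^1|u|\,\nu_\infty(du)<\infty$. Let $\varphi_\infty$ be the characteristic function of $X_\infty$, and assume that for some $C_\infty>0$ and $p_\infty\ge1$, $$|\varphi_\infty(t)|\int_0^{|t|}\frac{ds}{|\varphi_\infty(s)|}\le C_\infty|t|^{p_\infty}\qquad\text{for all }t\in\mathbb R.$$ Assume also that the law of $X_\infty$ is absolutely continuous with respect to Lebesgue measure with a density bounded by $M$. Let $(m_0^n)^\pm,Y_n^\pm$ and $(m_0^\infty)^\pm,Y_\infty^\pm$ be the quantities above associated with $X_n$ and $X_\infty$, where all the variables $Y_n^\pm,Y_\infty^\pm$ are defined on one probability space with an arbitrary joint law, and let $$\Delta_n=|(m_0^n)^+-(m_0^\infty)^+|+|(m_0^n)^--(m_0^\infty)^-|+(m_0^\infty)^+\,\mathbb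 E|Y_n^+-Y_\infty^+|+(m_0^\infty)^-\,\mathbb E|Y_n^--Y_\infty^-|\in[0,\infty],$$ where a product with a factor $(m_0^\infty)^\pm=0$ is $0$. Then for all $n\ge1$, $$d_K(X_n,X_\infty)\le C'_\infty\,\Delta_n^{\frac1{p_\infty+2}},$$ where $C'_\infty>0$ depends only on $C_\infty$, $p_\infty$ and $M$. -/

import Mathlib

open MeasureTheory ProbabilityTheory Filter
open scoped ENNReal Topology

noncomputable section

namespace InfDiv

/-- A Lévy measure on `ℝ`: a Borel measure with no mass at the origin and `∫ min(1, u²) ν(du) < ∞`. -/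
def IsLevyMeasure (ν : Measure ℝ) : Prop :=
  ν {0} = 0 ∧ ∫⁻ u, ENNReal.ofReal (min 1 (u ^ 2)) ∂ν < ⊤

/-- `X ∼ ID(b, σ², ν)` under `P` (here `sigmaSq` is `σ²`): `ν` is a Lévy measure and
`φ_X(t) = exp (i t b - σ² t² / 2 + ∫ (e^{itu} - 1 - i t u 1_{|u| ≤ 1}) ν(du))` for all `t`. -/
def IsID {Ω : Type*} [MeasurableSpace Ω] (X : Ω → ℝ) (P : Measure Ω)
    (b sigmaSq : ℝ) (ν : Measure ℝ) : Prop :=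
  AEMeasurable X P ∧ 0 ≤ sigmaSq ∧ IsLevyMeasure ν ∧
    ∀ t : ℝ, charFun (P.map X) t =
      Complex.exp (Complex.I * t * b - sigmaSq * t ^ 2 / 2 +
        ∫ u : ℝ, (Complex.exp (Complex.I * t * u) - 1
          - Complex.I * t * u * {v : ℝ | |v| ≤ 1}.indicator (fun _ => (1 : ℂ)) u) ∂ν)

/-- `X` is not almost surely equal to a constant. -/
def Nondegenerate {Ω : Type*} [MeasurableSpace Ω] (X : Ω → ℝ) (P : Measure Ω) : Prop :=
  ∀ c : ℝ, ¬ X =ᵐ[P] fun _ => c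

/-- The drift `b₀ = b - ∫_{[-1,1]} u ν(du)`. -/
def drift (b : ℝ) (ν : Measure ℝ) : ℝ := b - ∫ u in Set.Icc (-1 : ℝ) 1, u ∂ν

/-- The positive part `u 1_{u > 0} ν(du)` of the signed measure `u ν(du)`. -/
def tiltPos (ν : Measure ℝ) : Measure ℝ := ν.withDensity fun u => ENNReal.ofReal u

/-- The negative part `(-u) 1_{u < 0} ν(du)` of the signed measure `u ν(du)`. -/
def tiltNeg (ν : Measure ℝ) : Measure ℝ := ν.withDensity fun u => ENNReal.ofReal (-u)

/-- `m₀⁺ = max(b₀, 0) + ∫ u 1_{u > 0} ν(du)`. -/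
def massPos (b : ℝ) (ν : Measure ℝ) : ℝ := max (drift b ν) 0 + (tiltPos ν).real Set.univ

/-- `m₀⁻ = max(-b₀, 0) + ∫ (-u) 1_{u < 0} ν(du)`. -/
def massNeg (b : ℝ) (ν : Measure ℝ) : ℝ := max (-drift b ν) 0 + (tiltNeg ν).real Set.univ

/-- The law `(b₀⁺ / m₀⁺) δ₀ + u 1_{u > 0} ν(du) / m₀⁺` of `Y⁺` (meaningful when `m₀⁺ ≠ 0`). -/
def sizeBiasPos (b : ℝ) (ν : Measure ℝ) : Measure ℝ :=
  (ENNReal.ofReal (massPos b ν))⁻¹ •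
    (ENNReal.ofReal (drift b ν) • Measure.dirac 0 + tiltPos ν)

/-- The law `(b₀⁻ / m₀⁻) δ₀ + (-u) 1_{u < 0} ν(du) / m₀⁻` of `Y⁻` (meaningful when `m₀⁻ ≠ 0`). -/
def sizeBiasNeg (b : ℝ) (ν : Measure ℝ) : Measure ℝ :=
  (ENNReal.ofReal (massNeg b ν))⁻¹ •
    (ENNReal.ofReal (-drift b ν) • Measure.dirac 0 + tiltNeg ν)

/-- The Kolmogorov distance `sup_x |P(X ≤ x) - Q(Z ≤ x)|`. -/
def kolmogorovDist {Ω Ω' : Type*} [MeasurableSpace Ω] [MeasurableSpace Ω']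
    (X : Ω → ℝ) (P : Measure Ω) (Z : Ω' → ℝ) (Q : Measure Ω') : ℝ :=
  ⨆ x : ℝ, |P.real {ω | X ω ≤ x} - Q.real {ω | Z ω ≤ x}|

/-- `E |Y - Z|`, with values in `[0, ∞]`. -/
def meanAbsDiff {Ω : Type*} [MeasurableSpace Ω] (Q : Measure Ω) (Y Z : Ω → ℝ) : ℝ≥0∞ :=
  ∫⁻ ω, ENNReal.ofReal |Y ω - Z ω| ∂Q

end InfDiv

end

/-! Write `m₀⁺`, `m₀⁻` for the total masses of `biasPos`, `biasNeg`, and let `a` be the difference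
of the characteristic functions of these two measures. Without Gaussian part, the characteristic
function of `X` solves the linear equation `φ' = i a φ` (`IsID.hasDerivAt_charFun`). This requires a
Lévy measure with a first moment, obtained from that of `X` in `IsID.integrable_levyMeasure`.

Changing masses and size-bias variables by a total of `Δ` moves `a(s)` by at most `Δ(1 + s)` for `s
≥ 0` (`norm_charFun_sub_charFun_le`). Since `(φ_n/φ_∞)' = i (a_n - a_∞) φ_n/φ_∞` and `|φ_n| ≤ 1`,
integration gives, for `t > 0`, `|φ_n - φ_∞|(t) ≤ Δ(1 + t) |φ_∞(t)| ∫₀ᵗ ds/|φ_∞(s)| ≤ C Δ (1 + t)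
t^p` (`norm_sub_le_of_hasDerivAt`).

A smoothing inequality (`esseen_smoothing`) converts this into `d_K ≲ C Δ (1 + T) T^p + M/T` for
every `T > 0`. For `T ≥ 1` the first term is of order `Δ T^(p+1)`, so `T = Δ^(-1/(p+2))` balances
the two; for `Δ ≥ 1` the bound is trivial (`le_mul_rpow_of_forall_pos`). -/

namespace InfDiv

/-! ### The Fejér kernel -/

/-- The (unnormalized) Fejér kernel. -/
noncomputable def fejer (u : ℝ) : ℝ := ∫ t in (0 : ℝ)..1, (1 - t) * Real.cos (t * u)

lemma fejer_of_ne_zero {u : ℝ} (hu : u ≠ 0) : fejer u = (1 - Real.cos u) / u ^ 2 := by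
  have h : ∀ t ∈ Set.uIcc (0 : ℝ) 1, HasDerivAt
      (fun t : ℝ => (1 - t) * (Real.sin (t * u) / u) - Real.cos (t * u) / u ^ 2)
      ((1 - t) * Real.cos (t * u)) t := by
    intro t _
    have h1 : HasDerivAt (fun t : ℝ => t * u) u t := by
      simpa using (hasDerivAt_id t).mul_const u
    have h2 := (((hasDerivAt_id t).const_sub 1).mul (h1.sin.div_const u)).sub
      (h1.cos.div_const (u ^ 2))
    refine HasDerivAt.congr_deriv h2 ?_
    simp only [id]
    field_simp
    ring
  rw [fejer, intervalIntegral.integral_eq_sub_of_hasDerivAt h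
    (Continuous.intervalIntegrable (by fun_prop) _ _)]
  simp
  field_simp
  ring

lemma fejer_zero : fejer 0 = 1 / 2 := by
  have h : ∀ t ∈ Set.uIcc (0 : ℝ) 1, HasDerivAt (fun t : ℝ => t - t ^ 2 / 2) (1 - t) t := by
    intro t _
    exact ((hasDerivAt_id t).sub ((hasDerivAt_pow 2 t).div_const 2)).congr_deriv (by simp)
  simp only [fejer, mul_zero, Real.cos_zero, mul_one]
  rw [intervalIntegral.integral_eq_sub_of_hasDerivAt h
    (Continuous.intervalIntegrable (by fun_prop) _ _)]
  norm_num

lemma fejer_nonneg (u : ℝ) : 0 ≤ fejer u := by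
  rcases eq_or_ne u 0 with rfl | hu
  · norm_num [fejer_zero]
  · rw [fejer_of_ne_zero hu]
    have := Real.cos_le_one u
    exact div_nonneg (by linarith) (sq_nonneg u)

@[fun_prop]
lemma continuous_fejer : Continuous fejer := by
  unfold fejer
  exact intervalIntegral.continuous_parametric_intervalIntegral_of_continuous'
    (by simp only [Function.uncurry_def]; fun_prop) _ _

lemma fejer_le (u : ℝ) : fejer u ≤ 3 * (1 + u ^ 2)⁻¹ := by
  rcases eq_or_ne u 0 with rfl | hu
  · norm_num [fejer_zero]
  -- In `(1 - cos u)(1 + u²)`, bound `1 - cos u` by `u²/2` against `1` and by `2` against `u²`; the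
  -- total `5u²/2` is below `3u²`.
  · have h1 := Real.one_sub_sq_div_two_le_cos (x := u)
    have h2 := Real.neg_one_le_cos u
    have hu2 : 0 < u ^ 2 := by positivity
    rw [fejer_of_ne_zero hu, ← div_eq_mul_inv, div_le_div_iff₀ hu2 (by positivity)]
    nlinarith

lemma integrable_fejer : Integrable fejer := by
  refine (integrable_inv_one_add_sq.const_mul 3).mono' (by fun_prop) ?_
  filter_upwards with u
  rw [Real.norm_of_nonneg (fejer_nonneg u)]
  exact fejer_le u

lemma integral_fejer_pos : 0 < ∫ u, fejer u :=
  integral_pos_of_integrable_nonneg_nonzero continuous_fejer integrable_fejer fejer_nonneg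
    (x := 0) (by norm_num [fejer_zero])

lemma sq_mul_fejer_mul {t : ℝ} (ht : t ≠ 0) (u : ℝ) :
    u ^ 2 * fejer (t * u) = (1 - Real.cos (t * u)) / t ^ 2 := by
  rcases eq_or_ne u 0 with rfl | hu
  · simp
  · rw [fejer_of_ne_zero (mul_ne_zero ht hu)]
    field_simp

/-- By scaling. For `t ≠ 0` the integrand is `(1 - cos(tu))/t²`, so integrating in `t` recovers
`|u|` from cosines. This is what later turns bounds on characteristic functions into bounds on first
moments. -/
lemma lintegral_sq_mul_fejer (u : ℝ) :
    ∫⁻ t, ENNReal.ofReal (u ^ 2 * fejer (t * u)) =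
      ENNReal.ofReal (∫ u, fejer u) * ENNReal.ofReal |u| := by
  rcases eq_or_ne u 0 with rfl | hu
  · simp
  have hi : Integrable (fun t => u ^ 2 * fejer (t * u)) :=
    (integrable_fejer.comp_mul_right' hu).const_mul _
  rw [← ofReal_integral_eq_lintegral_ofReal hi
    (ae_of_all _ fun t => mul_nonneg (sq_nonneg u) (fejer_nonneg _)),
    ← ENNReal.ofReal_mul integral_fejer_pos.le, integral_const_mul,
    Measure.integral_comp_mul_right]
  congr 1
  rw [smul_eq_mul, abs_inv, ← sq_abs u]
  have : |u| ≠ 0 := abs_ne_zero.2 hu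
  field_simp

/-! ### Fejér averages of distribution functions and smoothing -/

lemma integral_zero_fejer (y : ℝ) :
    ∫ u in (0 : ℝ)..y, fejer u = ∫ t in (0 : ℝ)..1, (1 - t) * (Real.sin (t * y) / t) := by
  unfold fejer
  rw [intervalIntegral_intervalIntegral_swap]
  · refine intervalIntegral.integral_congr_ae ?_
    filter_upwards [compl_mem_ae_iff.2 (measure_singleton (0 : ℝ))] with t ht _
    have ht : t ≠ 0 := ht
    rw [intervalIntegral.integral_const_mul,
      intervalIntegral.integral_comp_mul_left (fun x => Real.cos x) ht]
    simp [div_eq_inv_mul]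
  · refine IntegrableOn.mono_set (ContinuousOn.integrableOn_compact
      (isCompact_uIcc.prod isCompact_uIcc) ?_) (Set.prod_mono Set.uIoc_subset_uIcc Set.uIoc_subset_uIcc)
    simp only [Function.uncurry_def]
    fun_prop

lemma abs_sin_mul_div_le (t z : ℝ) : |Real.sin (t * z) / t| ≤ |z| := by
  rcases eq_or_ne t 0 with rfl | ht
  · simp
  · rw [abs_div, div_le_iff₀ (abs_pos.2 ht), mul_comm |z|, ← abs_mul]
    exact Real.abs_sin_le_abs

/-- Fubini on the region `u ≤ T(x - y)`, which for `T > 0` is `y ≤ x - u/T`. -/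
lemma integral_setIntegral_Iic_fejer (μ : Measure ℝ) [IsProbabilityMeasure μ] {T : ℝ} (hT : 0 < T)
    (x : ℝ) :
    ∫ y, (∫ u in Set.Iic (T * (x - y)), fejer u) ∂μ =
      ∫ u, fejer u * μ.real (Set.Iic (x - u / T)) := by
  have hs : MeasurableSet {q : ℝ × ℝ | q.2 ≤ T * (x - q.1)} :=
    measurableSet_le (by fun_prop) (by fun_prop)
  have h1 : ∀ y, ∫ u in Set.Iic (T * (x - y)), fejer u =
      ∫ u, {q : ℝ × ℝ | q.2 ≤ T * (x - q.1)}.indicator (fun q => fejer q.2) (y, u) := by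
    intro y
    rw [← integral_indicator measurableSet_Iic]
    rfl
  simp_rw [h1]
  rw [integral_integral_swap
    (f := fun y u => {q : ℝ × ℝ | q.2 ≤ T * (x - q.1)}.indicator (fun q => fejer q.2) (y, u))]
  · refine integral_congr_ae (ae_of_all _ fun u => ?_)
    have h2 : (fun y => {q : ℝ × ℝ | q.2 ≤ T * (x - q.1)}.indicator (fun q => fejer q.2) (y, u)) =
        (Set.Iic (x - u / T)).indicator (fun _ => fejer u) := by
      ext y
      have : u ≤ T * (x - y) ↔ y ≤ x - u / T := by
        rw [le_sub_comm, div_le_iff₀ hT, mul_comm]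
      simp [Set.indicator, this]
    simp only [h2]
    rw [integral_indicator_const _ measurableSet_Iic, smul_eq_mul, mul_comm]
  · have := (integrable_fejer.comp_snd μ).indicator hs
    exact this

/-- The first moment serves here: the singular factor `1/t` is absorbed by `|sin(tz)/t| ≤ |z|`,
leaving an integrable function of `y`. -/
lemma integrable_sin_div (μ : Measure ℝ) [IsProbabilityMeasure μ]
    (hμ : Integrable (fun y => y) μ) (T x : ℝ) :
    Integrable (Function.uncurry fun (t y : ℝ) => (1 - t) * (Real.sin (t * (T * (x - y))) / t))
      ((volume.restrict (Set.uIoc 0 1)).prod μ) := by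
  have hb : Integrable (fun y => |T * (x - y)|) μ :=
    (((integrable_const x).sub hμ).const_mul T).abs
  have : IsFiniteMeasure (volume.restrict (Set.uIoc (0 : ℝ) 1)) := ⟨by simp⟩
  refine (hb.comp_snd (volume.restrict (Set.uIoc (0 : ℝ) 1))).mono'
    (Measurable.aestronglyMeasurable (by simp only [Function.uncurry_def]; fun_prop)) ?_
  have hae : ∀ᵐ t : ℝ ∂(volume.restrict (Set.uIoc (0 : ℝ) 1)), |1 - t| ≤ 1 := by
    filter_upwards [ae_restrict_mem measurableSet_uIoc] with t ht
    rw [Set.uIoc_of_le zero_le_one] at ht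
    rw [abs_le]
    constructor <;> linarith [ht.1, ht.2]
  filter_upwards [Measure.quasiMeasurePreserving_fst.ae hae] with q hq
  simp only [Function.uncurry_def, Real.norm_eq_abs, abs_mul (1 - q.1)]
  have := abs_sin_mul_div_le q.1 (T * (x - q.2))
  calc _ ≤ 1 * |T * (x - q.2)| := mul_le_mul hq this (abs_nonneg _) zero_le_one
    _ = _ := one_mul _

lemma integral_sin_eq_im (μ : Measure ℝ) [IsProbabilityMeasure μ] (s x : ℝ) :
    ∫ y, Real.sin (s * (x - y)) ∂μ =
      (Complex.exp ((s * x : ℝ) * Complex.I) * charFun μ (-s)).im := by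
  have hi : Integrable (fun y : ℝ => Complex.exp ((s * (x - y) : ℝ) * Complex.I)) μ := by
    refine (integrable_const (1 : ℝ)).mono'
      (Continuous.aestronglyMeasurable (by fun_prop)) (ae_of_all _ fun y => ?_)
    rw [Complex.norm_exp_ofReal_mul_I]
  rw [charFun_apply_real, ← integral_const_mul]
  have h : ∀ y : ℝ, Complex.exp ((s * x : ℝ) * Complex.I) *
      Complex.exp (((-s : ℝ) : ℂ) * y * Complex.I) =
        Complex.exp ((s * (x - y) : ℝ) * Complex.I) := by
    intro y
    rw [← Complex.exp_add]
    congr 1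
    push_cast
    ring
  simp_rw [h]
  have h2 := integral_im hi
  simp only [RCLike.im_to_complex, Complex.exp_ofReal_mul_I_im] at h2
  exact h2

/-- The Fourier transform of the kernel lives on a bounded interval, so only frequencies up to `T`
enter. The factor `1/t` produced by passing from laws to distribution functions is cancelled by the
factor `t` in the hypothesis. -/
lemma abs_integral_fejer_mul_le (μ γ : Measure ℝ) [IsProbabilityMeasure μ] [IsProbabilityMeasure γ]
    (hμ : Integrable (fun y => y) μ) (hγ : Integrable (fun y => y) γ)
    {T W : ℝ} (hT : 0 < T) (hW : ∀ t, 0 < t → t ≤ T → ‖charFun μ t - charFun γ t‖ ≤ t * W) (x : ℝ) :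
    |(∫ u, fejer u * μ.real (Set.Iic (x - u / T))) -
      ∫ u, fejer u * γ.real (Set.Iic (x - u / T))| ≤ T * W := by
  -- The constant `∫_{u ≤ 0} fejer` does not depend on the law and cancels in the difference.
  have key : ∀ ρ : Measure ℝ, IsProbabilityMeasure ρ → Integrable (fun y => y) ρ →
      (∫ u, fejer u * ρ.real (Set.Iic (x - u / T))) = (∫ u in Set.Iic 0, fejer u) +
        ∫ t in (0 : ℝ)..1, ∫ y, (1 - t) * (Real.sin (t * (T * (x - y))) / t) ∂ρ := by
    intro ρ _ hρ
    have hi := integrable_sin_div ρ hρ T x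
    rw [← integral_setIntegral_Iic_fejer ρ hT, intervalIntegral_integral_swap hi]
    have h1 : ∀ y : ℝ, ∫ u in Set.Iic (T * (x - y)), fejer u = (∫ u in Set.Iic 0, fejer u) +
        ∫ t in (0 : ℝ)..1, (1 - t) * (Real.sin (t * (T * (x - y))) / t) := by
      intro y
      rw [← integral_zero_fejer, ← intervalIntegral.integral_Iic_sub_Iic
        integrable_fejer.integrableOn integrable_fejer.integrableOn]
      ring
    simp_rw [h1]
    rw [integral_add (integrable_const _)]
    · simp
    · have := hi.integral_prod_right
      simp only [Function.uncurry_apply_pair] at this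
      simpa only [intervalIntegral.intervalIntegral_eq_integral_uIoc, zero_le_one, if_true,
        one_smul] using this
  have hint : ∀ ρ : Measure ℝ, IsProbabilityMeasure ρ → Integrable (fun y => y) ρ →
      IntervalIntegrable (fun t => ∫ y, (1 - t) * (Real.sin (t * (T * (x - y))) / t) ∂ρ)
        volume 0 1 := by
    intro ρ _ hρ
    rw [intervalIntegrable_iff]
    have := (integrable_sin_div ρ hρ T x).integral_prod_left
    simpa only [Function.uncurry_apply_pair, IntegrableOn] using this
  rw [key μ inferInstance hμ, key γ inferInstance hγ, add_sub_add_left_eq_sub,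
    ← intervalIntegral.integral_sub (hint μ inferInstance hμ) (hint γ inferInstance hγ)]
  have := intervalIntegral.norm_integral_le_of_norm_le_const (a := (0 : ℝ)) (b := 1) (C := T * W)
    (f := fun t => (∫ y, (1 - t) * (Real.sin (t * (T * (x - y))) / t) ∂μ) -
      ∫ y, (1 - t) * (Real.sin (t * (T * (x - y))) / t) ∂γ) ?_
  · simpa using this
  intro t ht
  rw [Set.uIoc_of_le zero_le_one] at ht
  obtain ⟨ht0, ht1⟩ := ht
  have h2 : ∀ ρ : Measure ℝ, IsProbabilityMeasure ρ →
      ∫ y, (1 - t) * (Real.sin (t * (T * (x - y))) / t) ∂ρ = (1 - t) / t *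
        (Complex.exp ((t * T * x : ℝ) * Complex.I) * charFun ρ (-(t * T))).im := by
    intro ρ _
    rw [← integral_sin_eq_im, ← integral_const_mul]
    refine integral_congr_ae (ae_of_all _ fun y => ?_)
    simp only [mul_assoc]
    ring
  rw [h2 μ inferInstance, h2 γ inferInstance, ← mul_sub, ← Complex.sub_im, ← mul_sub, charFun_neg,
    charFun_neg, ← map_sub, norm_mul]
  have htT : 0 < t * T := by positivity
  have h3 : ‖(Complex.exp ((t * T * x : ℝ) * Complex.I) *
      (starRingEnd ℂ) (charFun μ (t * T) - charFun γ (t * T))).im‖ ≤ t * T * W := by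
    refine (Complex.abs_im_le_norm _).trans ?_
    rw [norm_mul, Complex.norm_exp_ofReal_mul_I, one_mul, RCLike.norm_conj]
    exact hW _ htT (by nlinarith)
  have hW0 : 0 ≤ T * W := by
    have := (norm_nonneg _).trans h3
    have : 0 ≤ t * (T * W) := by linarith
    exact nonneg_of_mul_nonneg_right this ht0
  rw [Real.norm_of_nonneg (div_nonneg (by linarith) ht0.le)]
  calc _ ≤ (1 - t) / t * (t * T * W) :=
        mul_le_mul_of_nonneg_left h3 (div_nonneg (by linarith) ht0.le)
    _ = (1 - t) * (T * W) := by field_simp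
    _ ≤ T * W := by nlinarith

lemma integrable_fejer_mul {d : ℝ → ℝ} (hd : Measurable d) {δ : ℝ} (hδ : ∀ x, |d x| ≤ δ)
    (x T : ℝ) : Integrable (fun u => fejer u * d (x - u / T)) :=
  integrable_fejer.mul_bdd (c := δ) (hd.comp (by fun_prop)).aestronglyMeasurable
    (ae_of_all _ fun _ => hδ _)

/-- Use `d ≥ e` on the window `[-a, a]` and only `d ≥ -δ` outside it. -/
lemma le_integral_fejer_mul {d : ℝ → ℝ} (hd : Measurable d) {δ : ℝ} (hδ : ∀ x, |d x| ≤ δ)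
    {a e x T : ℝ} (h : ∀ u ∈ Set.Icc (-a) a, e ≤ d (x - u / T)) :
    (∫ u in Set.Icc (-a) a, fejer u) * (e + δ) - (∫ u, fejer u) * δ ≤
      ∫ u, fejer u * d (x - u / T) := by
  have hI : Integrable (fun u => (Set.Icc (-a) a).indicator fejer u * (e + δ)) :=
    (integrable_fejer.indicator measurableSet_Icc).mul_const _
  rw [← integral_indicator measurableSet_Icc, ← integral_mul_const, ← integral_mul_const,
    ← integral_sub hI (integrable_fejer.mul_const _)]
  refine integral_mono (hI.sub (integrable_fejer.mul_const _)) (integrable_fejer_mul hd hδ x T) ?_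
  intro u
  have hk := fejer_nonneg u
  by_cases hu : u ∈ Set.Icc (-a) a
  · simp only [Set.indicator_of_mem hu]
    nlinarith [mul_le_mul_of_nonneg_left (h u hu) hk]
  · simp only [Set.indicator_of_notMem hu]
    nlinarith [mul_le_mul_of_nonneg_left (abs_le.1 (hδ (x - u / T))).1 hk]

/-- Any fraction above `1/2` would serve; `3/4` makes the tail cost `(1/4)/(3/4) = 1/3` of the
supremum, which can be absorbed. -/
lemma exists_setIntegral_fejer_ge :
    ∃ a : ℝ, 0 < a ∧ 3 / 4 * (∫ u, fejer u) ≤ ∫ u in Set.Icc (-a) a, fejer u := by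
  have h := intervalIntegral_tendsto_integral integrable_fejer tendsto_neg_atTop_atBot tendsto_id
  have h1 : 3 / 4 * (∫ u, fejer u) < ∫ u, fejer u := by linarith [integral_fejer_pos]
  obtain ⟨a, ha, ha0⟩ := ((h.eventually_const_le h1).and (eventually_gt_atTop 0)).exists
  refine ⟨a, ha0, ?_⟩
  rwa [integral_Icc_eq_integral_Ioc, ← intervalIntegral.integral_of_le (by simp; linarith)]

lemma measurable_real_Iic (μ : Measure ℝ) [IsProbabilityMeasure μ] :
    Measurable fun x => μ.real (Set.Iic x) :=
  Monotone.measurable fun _ _ hxy => measureReal_mono (Set.Iic_subset_Iic.2 hxy)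

/-- One-sided smoothing bound: if `d` is at least `d x - M r` at distance `r` from `x` on one
side (given by the sign `σ`), its value at `x` is controlled by its Fejér averages. -/
lemma le_of_abs_integral_fejer_mul_le {d : ℝ → ℝ} (hd : Measurable d) {δ : ℝ}
    (hδ : ∀ x, |d x| ≤ δ) {a T M R : ℝ} (hT : 0 < T) (ha : 0 < a) (hM : 0 ≤ M)
    (hJ : 3 / 4 * (∫ u, fejer u) ≤ ∫ u in Set.Icc (-a) a, fejer u) {σ : ℝ}
    (hR : ∀ x, ∫ u, fejer u * d (x - u / T) ≤ R) (hσ : σ = 1 ∨ σ = -1)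
    (hlow : ∀ x r, 0 ≤ r → d x - M * r ≤ d (x + σ * r)) (hR0 : 0 ≤ R) (x : ℝ) :
    d x ≤ δ / 3 + (4 / (3 * ∫ u, fejer u) * R + 2 * a * M / T) := by
  have hL := integral_fejer_pos
  set L := ∫ u, fejer u
  have hδ0 : 0 ≤ δ := (abs_nonneg _).trans (hδ 0)
  have hB : 0 ≤ 2 * a * M / T := by positivity
  -- The remaining case makes `e + δ` nonnegative, as needed to replace the window mass by its lower
  -- bound `3/4` of the total.
  rcases le_or_gt (d x) (2 * a * M / T) with h | h
  · have : 0 ≤ 4 / (3 * L) * R := by positivity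
    linarith
  -- Recentering at `x + σ a/T` puts the whole window on the good side of `x`, at distances between
  -- `0` and `2a/T`.
  have h1 := le_integral_fejer_mul hd hδ (a := a) (e := d x - 2 * a * M / T)
    (x := x + σ * (a / T)) (T := T) ?_
  · have h2 := h1.trans (hR _)
    have h3 := mul_le_mul_of_nonneg_right hJ
      (show 0 ≤ d x - 2 * a * M / T + δ by linarith)
    have h4 : d x - 2 * a * M / T - δ / 3 ≤ 4 / (3 * L) * R := by
      rw [div_mul_eq_mul_div, le_div_iff₀ (by positivity)]
      nlinarith
    linarith
  · intro u hu
    obtain ⟨hu1, hu2⟩ := hu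
    have key : ∀ w, -a ≤ w → w ≤ a → d x - 2 * a * M / T ≤ d (x + σ * ((a + w) / T)) := by
      intro w hw1 hw2
      refine le_trans ?_ (hlow x ((a + w) / T) (div_nonneg (by linarith) hT.le))
      have : M * ((a + w) / T) ≤ 2 * a * M / T := by
        rw [mul_div_assoc', div_le_div_iff_of_pos_right hT]
        nlinarith
      linarith
    rcases hσ with rfl | rfl
    · convert key (-u) (by linarith) (by linarith) using 2
      ring
    · convert key u hu1 hu2 using 2
      ring

/-- **Esseen's smoothing inequality**, for characteristic functions whose difference is `O(t)` on
`(0, T]`. -/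
theorem esseen_smoothing : ∃ A B : ℝ, 0 < A ∧ 0 < B ∧
    ∀ (μ γ : Measure ℝ) [IsProbabilityMeasure μ] [IsProbabilityMeasure γ],
      Integrable (fun y => y) μ → Integrable (fun y => y) γ →
      ∀ M T W : ℝ, 0 ≤ M → 0 < T → 0 ≤ W →
      (∀ x y, x ≤ y → γ.real (Set.Iic y) - γ.real (Set.Iic x) ≤ M * (y - x)) →
      (∀ t, 0 < t → t ≤ T → ‖charFun μ t - charFun γ t‖ ≤ t * W) →
      ∀ x, |μ.real (Set.Iic x) - γ.real (Set.Iic x)| ≤ A * (T * W) + B * M / T := by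
  obtain ⟨a, ha, hJ⟩ := exists_setIntegral_fejer_ge
  have hL := integral_fejer_pos
  refine ⟨3 / 2 * (4 / (3 * ∫ u, fejer u)), 3 / 2 * (2 * a), by positivity, by positivity, ?_⟩
  intro μ γ _ _ hμ hγ M T W hM hT hW0 hlip hW
  have hb : ∀ x, |μ.real (Set.Iic x) - γ.real (Set.Iic x)| ≤ 1 := fun x => by
    rw [abs_le]
    constructor <;> linarith [measureReal_nonneg (μ := μ) (s := Set.Iic x),
      measureReal_nonneg (μ := γ) (s := Set.Iic x), measureReal_le_one (μ := μ) (s := Set.Iic x),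
      measureReal_le_one (μ := γ) (s := Set.Iic x)]
  have hbdd : BddAbove (Set.range fun x => |μ.real (Set.Iic x) - γ.real (Set.Iic x)|) :=
    ⟨1, by rintro _ ⟨x, rfl⟩; exact hb x⟩
  set δ := ⨆ x, |μ.real (Set.Iic x) - γ.real (Set.Iic x)| with hδ_def
  have hδ : ∀ x, |μ.real (Set.Iic x) - γ.real (Set.Iic x)| ≤ δ := le_ciSup hbdd
  have hone : ∀ (ρ : Measure ℝ) [IsProbabilityMeasure ρ] (x : ℝ), |ρ.real (Set.Iic x)| ≤ 1 :=
    fun ρ _ x => by rw [abs_of_nonneg measureReal_nonneg]; exact measureReal_le_one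
  have hD : ∀ x, |∫ u, fejer u * (μ.real (Set.Iic (x - u / T)) - γ.real (Set.Iic (x - u / T)))| ≤
      T * W := by
    intro x
    have := abs_integral_fejer_mul_le μ γ hμ hγ hT hW x
    rw [← integral_sub (integrable_fejer_mul (measurable_real_Iic μ) (hone μ) x T)
      (integrable_fejer_mul (measurable_real_Iic γ) (hone γ) x T)] at this
    simpa only [mul_sub] using this
  have hTW : 0 ≤ T * W := by positivity
  have hmono : ∀ (x y : ℝ), x ≤ y → μ.real (Set.Iic x) ≤ μ.real (Set.Iic y) := fun x y h =>
    measureReal_mono (Set.Iic_subset_Iic.2 h)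
  have h1 : ∀ x, μ.real (Set.Iic x) - γ.real (Set.Iic x) ≤
      δ / 3 + (4 / (3 * ∫ u, fejer u) * (T * W) + 2 * a * M / T) := by
    refine le_of_abs_integral_fejer_mul_le (d := fun x => μ.real (Set.Iic x) - γ.real (Set.Iic x))
      ((measurable_real_Iic μ).sub (measurable_real_Iic γ)) hδ hT ha hM hJ
      (fun x => (le_abs_self _).trans (hD x)) (Or.inl rfl) ?_ hTW
    intro x r hr
    -- Moving right, the distribution function of `μ` can only help and that of `γ` costs at most `M
    -- r`; for the opposite difference one moves left.
    have e1 := hmono x (x + 1 * r) (by linarith)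
    have e2 := hlip x (x + 1 * r) (by linarith)
    nlinarith
  have h2 : ∀ x, γ.real (Set.Iic x) - μ.real (Set.Iic x) ≤
      δ / 3 + (4 / (3 * ∫ u, fejer u) * (T * W) + 2 * a * M / T) := by
    refine le_of_abs_integral_fejer_mul_le (d := fun x => γ.real (Set.Iic x) - μ.real (Set.Iic x))
      ((measurable_real_Iic γ).sub (measurable_real_Iic μ))
      (fun x => by rw [abs_sub_comm]; exact hδ x) hT ha hM hJ
      (fun x => ?_) (Or.inr rfl) ?_ hTW
    · refine le_trans (le_of_eq ?_) ((neg_le_abs _).trans (hD x))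
      rw [← integral_neg]
      simp only [← mul_neg, neg_sub]
    · intro x r hr
      have e1 := hmono (x + -1 * r) x (by linarith)
      have e2 := hlip (x + -1 * r) x (by linarith)
      nlinarith
  -- Absorbing `δ/3` on the left produces the factor `3/2` in the constants.
  have h3 : δ ≤ δ / 3 + (4 / (3 * ∫ u, fejer u) * (T * W) + 2 * a * M / T) :=
    ciSup_le fun x => abs_le.2 ⟨by linarith [h2 x], h1 x⟩
  intro x
  refine (hδ x).trans ?_
  have : 3 / 2 * (2 * a) * M / T = 3 / 2 * (2 * a * M / T) := by ring
  rw [this]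
  linarith

/-! ### The Lévy–Khintchine exponent and the first moment of the Lévy measure -/

/-- The integrand of the Lévy–Khintchine exponent. -/
noncomputable def levyIntegrand (t u : ℝ) : ℂ :=
  Complex.exp (Complex.I * t * u) - 1
    - Complex.I * t * u * {v : ℝ | |v| ≤ 1}.indicator (fun _ => (1 : ℂ)) u

lemma measurable_levyIntegrand (t : ℝ) : Measurable (levyIntegrand t) := by
  have : MeasurableSet {v : ℝ | |v| ≤ 1} := measurableSet_le (by fun_prop) (by fun_prop)
  have h2 : Measurable ({v : ℝ | |v| ≤ 1}.indicator (fun _ => (1 : ℂ))) :=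
    measurable_const.indicator this
  unfold levyIntegrand
  fun_prop

lemma re_levyIntegrand (t u : ℝ) : (levyIntegrand t u).re = Real.cos (t * u) - 1 := by
  have h : Complex.I * t * u = ((t * u : ℝ) : ℂ) * Complex.I := by push_cast; ring
  unfold levyIntegrand
  rw [h]
  by_cases hu : u ∈ {v : ℝ | |v| ≤ 1}
  · rw [Set.indicator_of_mem hu]
    simp only [Complex.sub_re, Complex.exp_ofReal_mul_I_re, mul_one, Complex.re_ofReal_mul,
      Complex.I_re, Complex.one_re]
    ring
  · rw [Set.indicator_of_notMem hu]
    simp only [Complex.sub_re, Complex.exp_ofReal_mul_I_re, mul_zero, Complex.one_re,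
      Complex.zero_re]
    ring

lemma IsLevyMeasure.measure_compl_Icc_lt_top {ν : Measure ℝ} (hν : IsLevyMeasure ν) :
    ν (Set.Icc (-1) 1)ᶜ < ⊤ := by
  refine lt_of_le_of_lt ?_ hν.2
  rw [← lintegral_indicator_one measurableSet_Icc.compl]
  refine lintegral_mono fun u => ?_
  by_cases hu : u ∈ (Set.Icc (-1 : ℝ) 1)ᶜ
  · rw [Set.indicator_of_mem hu]
    have : 1 < |u| := by
      by_contra! h
      exact hu (abs_le.1 h)
    have h2 : 1 ≤ u ^ 2 := by
      rw [← sq_abs]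
      nlinarith
    simp [min_eq_left h2]
  · rw [Set.indicator_of_notMem hu]
    exact zero_le

/-- On `[-1, 1]` the first moment of the small jumps controls exponential and compensator
separately, without second-order cancellation; outside, the integrand is bounded by `2` and the
measure is finite. -/
lemma integrable_levyIntegrand {ν : Measure ℝ} (hν : IsLevyMeasure ν)
    (hs : IntegrableOn (fun u : ℝ => |u|) (Set.Icc (-1) 1) ν) (t : ℝ) :
    Integrable (levyIntegrand t) ν := by
  have h1 : Integrable ((Set.Icc (-1 : ℝ) 1).indicator fun u => |u|) ν :=
    (integrable_indicator_iff measurableSet_Icc).2 hs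
  have h2 : Integrable ((Set.Icc (-1 : ℝ) 1)ᶜ.indicator fun _ => (1 : ℝ)) ν :=
    (integrable_indicator_iff measurableSet_Icc.compl).2
      (integrableOn_const hν.measure_compl_Icc_lt_top.ne)
  refine ((h1.const_mul (2 * |t|)).add (h2.const_mul 2)).mono'
    (measurable_levyIntegrand t).aestronglyMeasurable (ae_of_all _ fun u => ?_)
  have h : Complex.I * t * u = Complex.I * ((t * u : ℝ) : ℂ) := by push_cast; ring
  have e1 : ‖Complex.exp (Complex.I * ((t * u : ℝ) : ℂ)) - 1‖ ≤ |t| * |u| := by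
    rw [← abs_mul]
    exact Real.norm_exp_I_mul_ofReal_sub_one_le
  simp only [Pi.add_apply]
  unfold levyIntegrand
  rw [h]
  by_cases hu : u ∈ Set.Icc (-1 : ℝ) 1
  · have hu' : u ∈ {v : ℝ | |v| ≤ 1} := abs_le.2 hu
    rw [Set.indicator_of_mem hu, Set.indicator_of_mem hu',
      Set.indicator_of_notMem (by simpa using hu)]
    refine (norm_sub_le _ _).trans ?_
    have e2 : ‖Complex.I * ((t * u : ℝ) : ℂ) * 1‖ = |t| * |u| := by
      simp
    linarith
  · have hu' : u ∉ {v : ℝ | |v| ≤ 1} := fun h => hu (abs_le.1 h)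
    rw [Set.indicator_of_notMem hu, Set.indicator_of_notMem hu',
      Set.indicator_of_mem (by simpa using hu), mul_zero, sub_zero]
    refine (norm_sub_le _ _).trans ?_
    rw [mul_comm Complex.I, Complex.norm_exp_ofReal_mul_I]
    norm_num

section IsID

variable {Ω : Type*} [MeasurableSpace Ω] {X : Ω → ℝ} {P : Measure Ω} {b : ℝ} {ν : Measure ℝ}

lemma IsID.charFun_eq (h : IsID X P b 0 ν) (t : ℝ) : charFun (P.map X) t =
    Complex.exp (Complex.I * t * b + ∫ u, levyIntegrand t u ∂ν) := by
  rw [h.2.2.2 t]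
  simp [levyIntegrand]

lemma IsID.charFun_ne_zero (h : IsID X P b 0 ν) (t : ℝ) : charFun (P.map X) t ≠ 0 := by
  rw [h.charFun_eq]
  exact Complex.exp_ne_zero _

lemma integrable_one_sub_cos (hν : IsLevyMeasure ν)
    (hs : IntegrableOn (fun u : ℝ => |u|) (Set.Icc (-1) 1) ν) (t : ℝ) :
    Integrable (fun u => 1 - Real.cos (t * u)) ν := by
  have := (integrable_levyIntegrand hν hs t).re.neg
  refine this.congr (ae_of_all _ fun u => ?_)
  simp [re_levyIntegrand]

lemma IsID.norm_charFun_eq (h : IsID X P b 0 ν)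
    (hs : IntegrableOn (fun u : ℝ => |u|) (Set.Icc (-1) 1) ν) (t : ℝ) :
    ‖charFun (P.map X) t‖ = Real.exp (-∫ u, (1 - Real.cos (t * u)) ∂ν) := by
  have h2 := integral_re (integrable_levyIntegrand h.2.2.1 hs t)
  simp only [RCLike.re_to_complex, re_levyIntegrand] at h2
  rw [h.charFun_eq, Complex.norm_exp, Complex.add_re, ← h2, ← integral_neg]
  simp

lemma re_charFun_eq (μ : Measure ℝ) [IsProbabilityMeasure μ] (t : ℝ) :
    (charFun μ t).re = ∫ x, Real.cos (t * x) ∂μ := by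
  have hi : Integrable (fun x : ℝ => Complex.exp ((t * x : ℝ) * Complex.I)) μ := by
    refine (integrable_const (1 : ℝ)).mono'
      (Continuous.aestronglyMeasurable (by fun_prop)) (ae_of_all _ fun y => ?_)
    rw [Complex.norm_exp_ofReal_mul_I]
  have h2 := integral_re hi
  simp only [RCLike.re_to_complex, Complex.exp_ofReal_mul_I_re] at h2
  rw [charFun_apply_real, h2]
  simp

lemma integrable_one_sub_cos_of_isFiniteMeasure (μ : Measure ℝ) [IsFiniteMeasure μ] (t : ℝ) :
    Integrable (fun x => 1 - Real.cos (t * x)) μ := by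
  refine (integrable_const (2 : ℝ)).mono'
    (Continuous.aestronglyMeasurable (by fun_prop)) (ae_of_all _ fun y => ?_)
  rw [Real.norm_eq_abs, abs_le]
  constructor <;> linarith [Real.cos_le_one (t * y), Real.neg_one_le_cos (t * y)]

lemma lintegral_lintegral_sq_mul_fejer (μ : Measure ℝ) [SFinite μ] :
    ∫⁻ t, (∫⁻ u, ENNReal.ofReal (u ^ 2 * fejer (t * u)) ∂μ) =
      ENNReal.ofReal (∫ u, fejer u) * ∫⁻ u, ENNReal.ofReal |u| ∂μ := by
  have h : Measurable (Function.uncurry fun t u : ℝ => ENNReal.ofReal (u ^ 2 * fejer (t * u))) :=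
    (ENNReal.continuous_ofReal.comp
      (by fun_prop : Continuous fun q : ℝ × ℝ => q.2 ^ 2 * fejer (q.1 * q.2))).measurable
  rw [lintegral_lintegral_swap h.aemeasurable]
  simp_rw [lintegral_sq_mul_fejer]
  rw [lintegral_const_mul _ (by fun_prop)]

/-- An infinitely divisible law with a first moment has a Lévy measure with a first moment. -/
theorem IsID.integrable_levyMeasure [IsProbabilityMeasure P] (h : IsID X P b 0 ν)
    (hs : IntegrableOn (fun u : ℝ => |u|) (Set.Icc (-1) 1) ν) (hX : Integrable X P) :
    Integrable (fun u : ℝ => u) ν := by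
  have hprob : IsProbabilityMeasure (P.map X) := Measure.isProbabilityMeasure_map h.1
  -- Only the large jumps are in question, and they form a finite measure.
  set ρ := ν.restrict (Set.Icc (-1 : ℝ) 1)ᶜ with hρ
  have hfin : IsFiniteMeasure ρ :=
    ⟨by rw [hρ, Measure.restrict_apply_univ]; exact h.2.2.1.measure_compl_Icc_lt_top⟩
  set c := Real.exp (-(2 * ρ.real Set.univ)) with hc
  have hc0 : 0 < c := Real.exp_pos _
  have key : ∀ t : ℝ, c * ∫ u, (1 - Real.cos (t * u)) ∂ρ ≤
      ∫ x, (1 - Real.cos (t * x)) ∂(P.map X) := by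
    intro t
    set g := ∫ u, (1 - Real.cos (t * u)) ∂ρ
    have hg0 : 0 ≤ g := integral_nonneg fun u => by
      have := Real.cos_le_one (t * u)
      simp only [Pi.zero_apply]
      linarith
    have hg1 : g ≤ 2 * ρ.real Set.univ := by
      have := integral_mono (integrable_one_sub_cos_of_isFiniteMeasure ρ t)
        (integrable_const (2 : ℝ)) fun u => by
          have := Real.neg_one_le_cos (t * u)
          simp only
          linarith
      refine this.trans (le_of_eq ?_)
      simp [mul_comm]
    have hg2 : g ≤ ∫ u, (1 - Real.cos (t * u)) ∂ν :=
      integral_mono_measure Measure.restrict_le_self (ae_of_all _ fun u => by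
        have := Real.cos_le_one (t * u)
        simp only [Pi.zero_apply]
        linarith) (integrable_one_sub_cos h.2.2.1 hs t)
    have e1 : 1 - ‖charFun (P.map X) t‖ ≤ ∫ x, (1 - Real.cos (t * x)) ∂(P.map X) := by
      have hcos : Integrable (fun x : ℝ => Real.cos (t * x)) (P.map X) := by
        have := (integrable_const (1 : ℝ)).sub
          (integrable_one_sub_cos_of_isFiniteMeasure (P.map X) t)
        simpa [Pi.sub_def] using this
      rw [integral_sub (integrable_const _) hcos, ← re_charFun_eq]
      simp only [integral_const, probReal_univ, smul_eq_mul, mul_one]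
      linarith [Complex.re_le_norm (charFun (P.map X) t)]
    refine le_trans ?_ e1
    rw [h.norm_charFun_eq hs]
    have e2 : Real.exp (-∫ u, (1 - Real.cos (t * u)) ∂ν) ≤ Real.exp (-g) :=
      Real.exp_le_exp.2 (by linarith)
    have e3 : c ≤ Real.exp (-g) := Real.exp_le_exp.2 (by linarith)
    -- This gives `1 - e^(-g) ≥ g e^(-g) ≥ c g`, where `c` comes from `g ≤ 2 ρ(ℝ)`.
    have e4 : Real.exp (-g) * (g + 1) ≤ 1 := by
      have := mul_le_mul_of_nonneg_left (Real.add_one_le_exp g) (Real.exp_pos (-g)).le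
      rwa [← Real.exp_add, neg_add_cancel, Real.exp_zero] at this
    nlinarith
  have toLint : ∀ (m : Measure ℝ) [IsFiniteMeasure m] (t : ℝ), t ≠ 0 →
      ∫⁻ u, ENNReal.ofReal (u ^ 2 * fejer (t * u)) ∂m =
        ENNReal.ofReal ((∫ u, (1 - Real.cos (t * u)) ∂m) / t ^ 2) := by
    intro m _ t ht
    simp_rw [sq_mul_fejer_mul ht]
    rw [← integral_div, ofReal_integral_eq_lintegral_ofReal
      ((integrable_one_sub_cos_of_isFiniteMeasure m t).div_const _)]
    refine ae_of_all _ fun u => ?_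
    have := Real.cos_le_one (t * u)
    exact div_nonneg (by linarith) (sq_nonneg t)
  -- Divide `key` by `t²` and integrate over `t`: both sides become first absolute moments, up to
  -- the same positive factor.
  have hlint : ENNReal.ofReal c * (ENNReal.ofReal (∫ u, fejer u) * ∫⁻ u, ENNReal.ofReal |u| ∂ρ) ≤
      ENNReal.ofReal (∫ u, fejer u) * ∫⁻ u, ENNReal.ofReal |u| ∂(P.map X) := by
    rw [← lintegral_lintegral_sq_mul_fejer, ← lintegral_lintegral_sq_mul_fejer,
      ← lintegral_const_mul' _ _ ENNReal.ofReal_ne_top]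
    refine lintegral_mono_ae ?_
    filter_upwards [compl_mem_ae_iff.2 (measure_singleton (0 : ℝ))] with t ht
    have ht : t ≠ 0 := ht
    rw [toLint ρ t ht, toLint (P.map X) t ht, ← ENNReal.ofReal_mul hc0.le]
    refine ENNReal.ofReal_le_ofReal ?_
    rw [← mul_div_assoc]
    exact div_le_div_of_nonneg_right (key t) (sq_nonneg t)
  have hXm : ∫⁻ u, ENNReal.ofReal |u| ∂(P.map X) < ⊤ := by
    have : Integrable (fun y : ℝ => y) (P.map X) :=
      (integrable_map_measure aestronglyMeasurable_id h.1).2 hX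
    have := this.hasFiniteIntegral
    rwa [hasFiniteIntegral_iff_norm] at this
  have hρm : ∫⁻ u, ENNReal.ofReal |u| ∂ρ < ⊤ := by
    rw [← mul_assoc] at hlint
    refine lt_top_iff_ne_top.2 fun htop => ?_
    rw [htop, ENNReal.mul_top] at hlint
    · exact (ENNReal.mul_lt_top ENNReal.ofReal_lt_top hXm).ne (top_le_iff.1 hlint)
    · exact mul_ne_zero (ENNReal.ofReal_pos.2 hc0).ne' (ENNReal.ofReal_pos.2 integral_fejer_pos).ne'
  have hI1 : IntegrableOn (fun u : ℝ => u) (Set.Icc (-1 : ℝ) 1)ᶜ ν :=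
    ⟨aestronglyMeasurable_id, by rwa [hasFiniteIntegral_iff_norm]⟩
  have hI2 : IntegrableOn (fun u : ℝ => u) (Set.Icc (-1 : ℝ) 1) ν :=
    (integrable_norm_iff aestronglyMeasurable_id).1 hs
  exact integrableOn_univ.1 (by simpa using hI2.union hI1)

end IsID

/-! ### The differential equation for the characteristic function -/

lemma integrable_exp_mul_I (μ : Measure ℝ) [IsFiniteMeasure μ] (t : ℝ) :
    Integrable (fun x : ℝ => Complex.exp (t * x * Complex.I)) μ := by
  refine (integrable_const (1 : ℝ)).mono'
    (Continuous.aestronglyMeasurable (by fun_prop)) (ae_of_all _ fun y => ?_)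
  rw [← Complex.ofReal_mul, Complex.norm_exp_ofReal_mul_I]

lemma charFun_smul (c : ℝ≥0∞) (μ : Measure ℝ) (t : ℝ) :
    charFun (c • μ) t = c.toReal * charFun μ t := by
  rw [charFun_apply_real, charFun_apply_real, integral_smul_measure, Complex.real_smul]

lemma charFun_add (μ γ : Measure ℝ) [IsFiniteMeasure μ] [IsFiniteMeasure γ] (t : ℝ) :
    charFun (μ + γ) t = charFun μ t + charFun γ t := by
  simp_rw [charFun_apply_real]
  exact integral_add_measure (integrable_exp_mul_I μ t) (integrable_exp_mul_I γ t)

/-- The unnormalized law of `Y⁺`. -/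
noncomputable def biasPos (b : ℝ) (ν : Measure ℝ) : Measure ℝ :=
  ENNReal.ofReal (drift b ν) • Measure.dirac 0 + tiltPos ν

/-- The unnormalized law of `Y⁻`. -/
noncomputable def biasNeg (b : ℝ) (ν : Measure ℝ) : Measure ℝ :=
  ENNReal.ofReal (-drift b ν) • Measure.dirac 0 + tiltNeg ν

lemma isFiniteMeasure_tiltPos {ν : Measure ℝ} (hν : Integrable (fun u : ℝ => u) ν) : IsFiniteMeasure (tiltPos ν) :=
  isFiniteMeasure_withDensity_ofReal hν.2

lemma isFiniteMeasure_tiltNeg {ν : Measure ℝ} (hν : Integrable (fun u : ℝ => u) ν) : IsFiniteMeasure (tiltNeg ν) :=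
  isFiniteMeasure_withDensity_ofReal hν.neg.2

lemma isFiniteMeasure_biasPos {ν : Measure ℝ} (hν : Integrable (fun u : ℝ => u) ν) (b : ℝ) :
    IsFiniteMeasure (biasPos b ν) := by
  have := isFiniteMeasure_tiltPos hν
  have := Measure.smul_finite (Measure.dirac (0 : ℝ)) (c := ENNReal.ofReal (drift b ν))
    ENNReal.ofReal_ne_top
  unfold biasPos
  infer_instance

lemma isFiniteMeasure_biasNeg {ν : Measure ℝ} (hν : Integrable (fun u : ℝ => u) ν) (b : ℝ) :
    IsFiniteMeasure (biasNeg b ν) := by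
  have := isFiniteMeasure_tiltNeg hν
  have := Measure.smul_finite (Measure.dirac (0 : ℝ)) (c := ENNReal.ofReal (-drift b ν))
    ENNReal.ofReal_ne_top
  unfold biasNeg
  infer_instance

lemma biasPos_real_univ {ν : Measure ℝ} (hν : Integrable (fun u : ℝ => u) ν) (b : ℝ) :
    (biasPos b ν).real Set.univ = massPos b ν := by
  have := isFiniteMeasure_tiltPos hν
  simp only [biasPos, massPos, Measure.real, Measure.add_apply, Measure.smul_apply, measure_univ,
    smul_eq_mul, mul_one]
  rw [ENNReal.toReal_add ENNReal.ofReal_ne_top (measure_ne_top _ _), ENNReal.toReal_ofReal']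

lemma biasNeg_real_univ {ν : Measure ℝ} (hν : Integrable (fun u : ℝ => u) ν) (b : ℝ) :
    (biasNeg b ν).real Set.univ = massNeg b ν := by
  have := isFiniteMeasure_tiltNeg hν
  simp only [biasNeg, massNeg, Measure.real, Measure.add_apply, Measure.smul_apply, measure_univ,
    smul_eq_mul, mul_one]
  rw [ENNReal.toReal_add ENNReal.ofReal_ne_top (measure_ne_top _ _), ENNReal.toReal_ofReal']

lemma charFun_biasPos_sub_charFun_biasNeg {ν : Measure ℝ} (hν : Integrable (fun u : ℝ => u) ν)
    (b t : ℝ) : charFun (biasPos b ν) t - charFun (biasNeg b ν) t =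
      drift b ν + ∫ u : ℝ, u * Complex.exp (t * u * Complex.I) ∂ν := by
  have := isFiniteMeasure_tiltPos hν
  have := isFiniteMeasure_tiltNeg hν
  have := Measure.smul_finite (Measure.dirac (0 : ℝ)) (c := ENNReal.ofReal (drift b ν))
    ENNReal.ofReal_ne_top
  have := Measure.smul_finite (Measure.dirac (0 : ℝ)) (c := ENNReal.ofReal (-drift b ν))
    ENNReal.ofReal_ne_top
  have hexp : ∀ f : ℝ → ℝ, Integrable f ν →
      Integrable (fun u : ℝ => f u • Complex.exp (t * u * Complex.I)) ν := by
    intro f hf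
    refine hf.norm.mono' (hf.1.smul (Continuous.aestronglyMeasurable (by fun_prop)))
      (ae_of_all _ fun u => ?_)
    rw [norm_smul, ← Complex.ofReal_mul, Complex.norm_exp_ofReal_mul_I, mul_one]
  have e1 : charFun (tiltPos ν) t = ∫ u : ℝ, max u 0 • Complex.exp (t * u * Complex.I) ∂ν := by
    rw [charFun_apply_real, tiltPos, integral_withDensity_eq_integral_toReal_smul (by fun_prop)
      (ae_of_all _ fun _ => ENNReal.ofReal_lt_top)]
    simp only [ENNReal.toReal_ofReal']
  have e2 : charFun (tiltNeg ν) t = ∫ u : ℝ, max (-u) 0 • Complex.exp (t * u * Complex.I) ∂ν := by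
    rw [charFun_apply_real, tiltNeg, integral_withDensity_eq_integral_toReal_smul (by fun_prop)
      (ae_of_all _ fun _ => ENNReal.ofReal_lt_top)]
    simp only [ENNReal.toReal_ofReal']
  have e3 : (∫ u : ℝ, max u 0 • Complex.exp (t * u * Complex.I) ∂ν) -
      ∫ u : ℝ, max (-u) 0 • Complex.exp (t * u * Complex.I) ∂ν =
        ∫ u : ℝ, u * Complex.exp (t * u * Complex.I) ∂ν := by
    rw [← integral_sub (hexp _ hν.pos_part) (hexp _ hν.neg_part)]
    refine integral_congr_ae (ae_of_all _ fun u => ?_)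
    simp only [Complex.real_smul]
    rw [← sub_mul, ← Complex.ofReal_sub, ← posPart_def, ← negPart_def, posPart_sub_negPart]
  have e4 : (drift b ν : ℂ) = ((ENNReal.ofReal (drift b ν)).toReal : ℂ) -
      (ENNReal.ofReal (-drift b ν)).toReal := by
    rw [ENNReal.toReal_ofReal', ENNReal.toReal_ofReal', ← Complex.ofReal_sub, ← posPart_def,
      ← negPart_def, posPart_sub_negPart]
  rw [biasPos, biasNeg, charFun_add, charFun_add, charFun_smul, charFun_smul, e1, e2, ← e3, e4]
  simp only [charFun_dirac, inner_zero_left, Complex.ofReal_zero, zero_mul, Complex.exp_zero,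
    mul_one]
  ring

/-- The characteristic function of an infinitely divisible law without Gaussian part solves
`φ' = i (m₊ φ₊ - m₋ φ₋) φ`. -/
lemma IsID.hasDerivAt_charFun {Ω : Type*} [MeasurableSpace Ω] {X : Ω → ℝ} {P : Measure Ω} {b : ℝ}
    {ν : Measure ℝ} (h : IsID X P b 0 ν) (hν : Integrable (fun u : ℝ => u) ν) (t : ℝ) :
    HasDerivAt (charFun (P.map X)) (Complex.I *
      (charFun (biasPos b ν) t - charFun (biasNeg b ν) t) * charFun (P.map X) t) t := by
  have hset : MeasurableSet {v : ℝ | |v| ≤ 1} := measurableSet_le (by fun_prop) (by fun_prop)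
  have hind : Measurable ({v : ℝ | |v| ≤ 1}.indicator (fun _ => (1 : ℂ))) :=
    measurable_const.indicator hset
  have hlin : ∀ c : ℂ, HasDerivAt (fun s : ℝ => Complex.I * s * c) (Complex.I * c) t := by
    intro c
    simpa using ((Complex.ofRealCLM.hasDerivAt (x := t)).const_mul Complex.I).mul_const c
  have hint := integrable_levyIntegrand h.2.2.1 (hν.norm.integrableOn) t
  -- Differentiation under the integral: exponential and compensator each contribute at most `|u|`
  -- to the derivative.
  have hmain := (hasDerivAt_integral_of_dominated_loc_of_deriv_le (μ := ν) (F := levyIntegrand)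
    (F' := fun s u => Complex.exp (Complex.I * s * u) * (Complex.I * u) -
      Complex.I * (u * {v : ℝ | |v| ≤ 1}.indicator (fun _ => (1 : ℂ)) u))
    (x₀ := t) (s := Set.univ) (bound := fun u => 2 * ‖u‖) univ_mem
    (Eventually.of_forall fun s => (measurable_levyIntegrand s).aestronglyMeasurable)
    hint (Measurable.aestronglyMeasurable (by fun_prop)) ?_ (hν.norm.const_mul 2) ?_).2
  · have e1 : (fun s : ℝ => charFun (P.map X) s) = fun s : ℝ =>
        Complex.exp (Complex.I * s * b + ∫ u, levyIntegrand s u ∂ν) := funext h.charFun_eq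
    have h1 := ((hlin b).add hmain).cexp
    rw [charFun_biasPos_sub_charFun_biasNeg hν]
    change HasDerivAt (fun s : ℝ => charFun (P.map X) s) _ t
    rw [e1]
    refine h1.congr_deriv ?_
    simp only [h.charFun_eq, Pi.add_apply]
    rw [mul_comm]
    congr 1
    have i1 : Integrable (fun u : ℝ => Complex.exp (Complex.I * t * u) * (Complex.I * u)) ν := by
      refine hν.norm.mono' (Continuous.aestronglyMeasurable (by fun_prop))
        (ae_of_all _ fun u => ?_)
      have : Complex.I * t * u = ((t * u : ℝ) : ℂ) * Complex.I := by push_cast; ring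
      rw [this, norm_mul, Complex.norm_exp_ofReal_mul_I]
      simp
    have e2 : ∀ u : ℝ, (u : ℂ) * {v : ℝ | |v| ≤ 1}.indicator (fun _ => (1 : ℂ)) u =
        (((Set.Icc (-1 : ℝ) 1).indicator (fun u => u) u : ℝ) : ℂ) := by
      intro u
      by_cases hu : u ∈ Set.Icc (-1 : ℝ) 1
      · rw [Set.indicator_of_mem hu, Set.indicator_of_mem (show u ∈ {v : ℝ | |v| ≤ 1} from
          abs_le.2 hu), mul_one]
      · rw [Set.indicator_of_notMem hu, Set.indicator_of_notMem
          (show u ∉ {v : ℝ | |v| ≤ 1} from fun hh => hu (abs_le.1 hh)), mul_zero,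
          Complex.ofReal_zero]
    have i2 : Integrable (fun u : ℝ =>
        Complex.I * (((Set.Icc (-1 : ℝ) 1).indicator (fun u => u) u : ℝ) : ℂ)) ν :=
      (hν.indicator measurableSet_Icc).ofReal.const_mul Complex.I
    simp_rw [e2]
    -- The compensator contributes `-i ∫_{[-1,1]} u dν`, which turns `b` into the drift.
    rw [integral_sub i1 i2,
      integral_const_mul, integral_complex_ofReal, integral_indicator measurableSet_Icc, drift]
    have e3 : ∀ u : ℝ, Complex.exp (Complex.I * t * u) * (Complex.I * u) =
        Complex.I * (u * Complex.exp (t * u * Complex.I)) := by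
      intro u
      rw [show Complex.I * t * u = t * u * Complex.I by ring]
      ring
    simp_rw [e3]
    rw [integral_const_mul]
    push_cast
    ring
  · refine ae_of_all _ fun u s _ => (norm_sub_le _ _).trans ?_
    have : Complex.I * s * u = ((s * u : ℝ) : ℂ) * Complex.I := by push_cast; ring
    rw [this, norm_mul, Complex.norm_exp_ofReal_mul_I]
    simp only [norm_mul, Complex.norm_I, one_mul, Complex.norm_real]
    have hle : ‖{v : ℝ | |v| ≤ 1}.indicator (fun _ => (1 : ℂ)) u‖ ≤ 1 :=
      (norm_indicator_le_norm_self _ _).trans (by simp)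
    nlinarith [norm_nonneg u]
  · refine ae_of_all _ fun u s _ => ?_
    have hl : ∀ c : ℂ, HasDerivAt (fun s : ℝ => Complex.I * s * c) (Complex.I * c) s := by
      intro c
      simpa using ((Complex.ofRealCLM.hasDerivAt (x := s)).const_mul Complex.I).mul_const c
    have := ((hl u).cexp.sub_const 1).sub
      (hl (u * {v : ℝ | |v| ≤ 1}.indicator (fun _ => (1 : ℂ)) u))
    refine HasDerivAt.congr_of_eventuallyEq this (Eventually.of_forall fun s => ?_)
    simp only [levyIntegrand, Pi.sub_apply]
    ring

/-! ### Perturbation of the equation -/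

/-- Stability of the characteristic function of a finite measure under perturbation of the total
mass and of the normalized law. -/
lemma norm_charFun_sub_charFun_le {Ω : Type*} [MeasurableSpace Ω] {Q : Measure Ω}
    [IsProbabilityMeasure Q] {σ₁ σ₂ : Measure ℝ} [IsFiniteMeasure σ₁] [IsFiniteMeasure σ₂]
    {m₁ m₂ : ℝ} (hm₁ : σ₁.real Set.univ = m₁) (hm₂ : σ₂.real Set.univ = m₂) {Y₁ Y₂ : Ω → ℝ}
    (h₁ : m₁ ≠ 0 → HasLaw Y₁ ((ENNReal.ofReal m₁)⁻¹ • σ₁) Q)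
    (h₂ : m₂ ≠ 0 → HasLaw Y₂ ((ENNReal.ofReal m₂)⁻¹ • σ₂) Q)
    (hfin : ENNReal.ofReal m₂ * meanAbsDiff Q Y₁ Y₂ ≠ ⊤) (t : ℝ) :
    ‖charFun σ₁ t - charFun σ₂ t‖ ≤
      |m₁ - m₂| + |t| * (ENNReal.ofReal m₂ * meanAbsDiff Q Y₁ Y₂).toReal := by
  have hm₁0 : 0 ≤ m₁ := hm₁ ▸ measureReal_nonneg
  have hm₂0 : 0 ≤ m₂ := hm₂ ▸ measureReal_nonneg
  have hR : 0 ≤ |t| * (ENNReal.ofReal m₂ * meanAbsDiff Q Y₁ Y₂).toReal := by positivity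
  have n₁ := norm_charFun_le (μ := σ₁) t
  have n₂ := norm_charFun_le (μ := σ₂) t
  rw [hm₁] at n₁
  rw [hm₂] at n₂
  -- When a mass vanishes nothing is known about the corresponding variable, but its measure is zero
  -- and the mass difference alone suffices.
  by_cases hz₁ : m₁ = 0
  · have : charFun σ₁ t = 0 := by rw [← norm_le_zero_iff]; linarith
    rw [this, zero_sub, norm_neg, hz₁, zero_sub, abs_neg]
    linarith [le_abs_self m₂]
  by_cases hz₂ : m₂ = 0
  · have : charFun σ₂ t = 0 := by rw [← norm_le_zero_iff]; linarith
    rw [this, sub_zero, hz₂, sub_zero]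
    rw [hz₂] at hR
    linarith [le_abs_self m₁]
  have law : ∀ (m : ℝ) (σ : Measure ℝ) (Y : Ω → ℝ), 0 ≤ m → m ≠ 0 →
      HasLaw Y ((ENNReal.ofReal m)⁻¹ • σ) Q → charFun σ t = m * charFun (Q.map Y) t := by
    intro m σ Y hm0 hm hY
    rw [hY.map_eq, charFun_smul, ENNReal.toReal_inv, ENNReal.toReal_ofReal hm0]
    push_cast
    rw [mul_inv_cancel_left₀ (by exact_mod_cast hm)]
  have a₁ := (h₁ hz₁).aemeasurable
  have a₂ := (h₂ hz₂).aemeasurable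
  have p₁ : IsProbabilityMeasure (Q.map Y₁) := Measure.isProbabilityMeasure_map a₁
  rw [law m₁ σ₁ Y₁ hm₁0 hz₁ (h₁ hz₁), law m₂ σ₂ Y₂ hm₂0 hz₂ (h₂ hz₂)]
  have hfin' : meanAbsDiff Q Y₁ Y₂ ≠ ⊤ := fun h => hfin (by
    rw [h, ENNReal.mul_top]
    exact (ENNReal.ofReal_pos.2 (lt_of_le_of_ne hm₂0 (Ne.symm hz₂))).ne')
  have hd : Integrable (fun ω => Y₁ ω - Y₂ ω) Q := by
    refine ⟨(a₁.sub a₂).aestronglyMeasurable, ?_⟩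
    rw [hasFiniteIntegral_iff_norm]
    exact lt_top_iff_ne_top.2 hfin'
  have hE : (meanAbsDiff Q Y₁ Y₂).toReal = ∫ ω, |Y₁ ω - Y₂ ω| ∂Q := by
    rw [meanAbsDiff, integral_eq_lintegral_of_nonneg_ae (ae_of_all _ fun _ => abs_nonneg _)
      hd.1.norm]
  have hexp : ∀ Y : Ω → ℝ, AEMeasurable Y Q → charFun (Q.map Y) t =
      ∫ ω, Complex.exp (t * Y ω * Complex.I) ∂Q ∧
      Integrable (fun ω => Complex.exp (t * Y ω * Complex.I)) Q := by
    intro Y hY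
    have := Measure.isProbabilityMeasure_map hY
    constructor
    · rw [charFun_apply_real, integral_map hY (Continuous.aestronglyMeasurable (by fun_prop))]
    · exact (integrable_map_measure (Continuous.aestronglyMeasurable (by fun_prop)) hY).1
        (integrable_exp_mul_I (Q.map Y) t)
  have hdiff : ‖charFun (Q.map Y₁) t - charFun (Q.map Y₂) t‖ ≤
      |t| * (meanAbsDiff Q Y₁ Y₂).toReal := by
    rw [(hexp Y₁ a₁).1, (hexp Y₂ a₂).1, ← integral_sub (hexp Y₁ a₁).2 (hexp Y₂ a₂).2, hE,
      ← integral_const_mul]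
    refine norm_integral_le_of_norm_le (hd.norm.const_mul |t|) (ae_of_all _ fun ω => ?_)
    have e : Complex.exp (t * Y₁ ω * Complex.I) - Complex.exp (t * Y₂ ω * Complex.I) =
        Complex.exp ((t * Y₂ ω : ℝ) * Complex.I) *
          (Complex.exp (Complex.I * ((t * (Y₁ ω - Y₂ ω) : ℝ) : ℂ)) - 1) := by
      rw [mul_sub, ← Complex.exp_add, mul_one]
      push_cast
      ring_nf
    rw [e, norm_mul, Complex.norm_exp_ofReal_mul_I, one_mul]
    refine Real.norm_exp_I_mul_ofReal_sub_one_le.trans ?_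
    rw [norm_mul, Real.norm_eq_abs, Real.norm_eq_abs]
  -- This splitting puts the weight `m₂`, the limiting mass, on the difference of the normalized
  -- laws.
  have e : (m₁ : ℂ) * charFun (Q.map Y₁) t - m₂ * charFun (Q.map Y₂) t =
      ((m₁ - m₂ : ℝ) : ℂ) * charFun (Q.map Y₁) t +
        m₂ * (charFun (Q.map Y₁) t - charFun (Q.map Y₂) t) := by
    push_cast
    ring
  rw [e, ENNReal.toReal_mul, ENNReal.toReal_ofReal hm₂0]
  refine (norm_add_le _ _).trans (add_le_add ?_ ?_)
  · rw [norm_mul, Complex.norm_real, Real.norm_eq_abs]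
    exact mul_le_of_le_one_right (abs_nonneg _) (norm_charFun_le_one t)
  · rw [norm_mul, Complex.norm_real, Real.norm_of_nonneg hm₂0]
    calc _ ≤ m₂ * (|t| * (meanAbsDiff Q Y₁ Y₂).toReal) := mul_le_mul_of_nonneg_left hdiff hm₂0
      _ = _ := by ring

/-- Comparison of two solutions of linear equations `f' = i a f`, `g' = i c g`. -/
lemma norm_sub_le_of_hasDerivAt {f g a c : ℝ → ℂ} {D : ℝ} (hD : 0 ≤ D)
    (hf : ∀ s, HasDerivAt f (Complex.I * a s * f s) s)
    (hg : ∀ s, HasDerivAt g (Complex.I * c s * g s) s)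
    (hg0 : ∀ s, g s ≠ 0) (h0 : f 0 = g 0) (hf1 : ∀ s, ‖f s‖ ≤ 1)
    (hac : ∀ s, 0 ≤ s → ‖a s - c s‖ ≤ D * (1 + s)) {t : ℝ} (ht : 0 ≤ t) :
    ‖f t - g t‖ ≤ D * (1 + t) * (‖g t‖ * ∫ s in (0 : ℝ)..t, 1 / ‖g s‖) := by
  have hgc : Continuous g := continuous_iff_continuousAt.2 fun s => (hg s).continuousAt
  have hcont : Continuous fun s => 1 / ‖g s‖ :=
    continuous_const.div hgc.norm fun s => norm_ne_zero_iff.2 (hg0 s)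
  have hd : ∀ s, HasDerivAt (fun s => f s / g s - 1) (Complex.I * (a s - c s) * (f s / g s)) s := by
    intro s
    refine (((hf s).div (hg s) (hg0 s)).sub_const 1).congr_deriv ?_
    have := hg0 s
    field_simp
  have hB : ∀ s, HasDerivAt (fun s => D * (1 + t) * ∫ r in (0 : ℝ)..s, 1 / ‖g r‖)
      (D * (1 + t) * (1 / ‖g s‖)) s := fun s =>
    (intervalIntegral.integral_hasDerivAt_right (hcont.intervalIntegrable _ _)
      (hcont.stronglyMeasurableAtFilter _ _) hcont.continuousAt).const_mul _
  -- No Grönwall factor arises: `|f/g| ≤ 1/|g|`, so the derivative bound does not involve the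
  -- unknown `f/g - 1`.
  have key := image_norm_le_of_norm_deriv_right_le_deriv_boundary
    (f := fun s => f s / g s - 1) (a := 0) (b := t)
    (fun s _ => (hd s).continuousAt.continuousWithinAt) (fun s _ => (hd s).hasDerivWithinAt)
    (by simp [h0, hg0]) hB ?_ (Set.right_mem_Icc.2 ht)
  · have e : f t - g t = (f t / g t - 1) * g t := by
      have := hg0 t
      field_simp
    rw [e, norm_mul]
    calc _ ≤ _ * ‖g t‖ := mul_le_mul_of_nonneg_right key (norm_nonneg _)
      _ = _ := by ring
  · intro s hs
    rw [norm_mul, norm_mul, Complex.norm_I, one_mul, norm_div]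
    refine mul_le_mul ((hac s hs.1).trans ?_)
      (div_le_div_of_nonneg_right (hf1 s) (norm_nonneg _)) (by positivity)
      (mul_nonneg hD (by linarith))
    exact mul_le_mul_of_nonneg_left (by linarith [hs.2]) hD

/-! ### Choice of the cutoff and conclusion -/

lemma le_mul_rpow_of_forall_pos {A B K D p : ℝ} (hA : 0 ≤ A) (hB : 0 ≤ B) (hp : 1 ≤ p) (hK : K ≤ 1)
    (hD : 0 ≤ D) (h : ∀ T, 0 < T → K ≤ A * (T * (D * (1 + T) * T ^ (p - 1))) + B / T) :
    K ≤ (2 * A + B + 1) * D ^ (1 / (p + 2)) := by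
  have hp2 : 0 < p + 2 := by linarith
  have hq : 0 < 1 / (p + 2) := by positivity
  rcases eq_or_lt_of_le hD with rfl | hD0
  · rw [Real.zero_rpow hq.ne', mul_zero]
    by_contra! hK0
    -- At `D = 0` the bound reads `K ≤ B/T`; this `T` is large enough to contradict `K > 0`.
    have h1 := h ((B + 1) / K) (by positivity)
    simp only [zero_mul, mul_zero, zero_add, div_div_eq_mul_div] at h1
    rw [le_div_iff₀ (by positivity)] at h1
    nlinarith
  rcases le_or_gt 1 D with hD1 | hD1
  · have : 1 ≤ D ^ (1 / (p + 2)) := Real.one_le_rpow hD1 hq.le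
    nlinarith
  set T := D ^ (-(1 / (p + 2))) with hT
  have hT0 : 0 < T := Real.rpow_pos_of_pos hD0 _
  -- Needed for `1 + T ≤ 2T`, the source of the factor `2`.
  have hT1 : 1 ≤ T := Real.one_le_rpow_of_pos_of_le_one_of_nonpos hD0 hD1.le (by linarith)
  have hTi : 1 / T = D ^ (1 / (p + 2)) := by
    rw [hT, Real.rpow_neg hD, one_div, inv_inv]
  have hTp : T * (D * T * T ^ (p - 1)) = D ^ (1 / (p + 2)) := by
    have : T * (D * T * T ^ (p - 1)) = D * T ^ (p + 1) := by
      rw [show p + 1 = 1 + 1 + (p - 1) by ring, Real.rpow_add hT0, Real.rpow_add hT0, Real.rpow_one]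
      ring
    rw [this, hT, ← Real.rpow_mul hD, ← Real.rpow_one_add' hD]
    · congr 1
      field_simp
      ring
    · have : 1 + -(1 / (p + 2)) * (p + 1) = 1 / (p + 2) := by
        field_simp
        ring
      rw [this]
      exact hq.ne'
  have h1 := h T hT0
  have h2 : T * (D * (1 + T) * T ^ (p - 1)) ≤ 2 * D ^ (1 / (p + 2)) := by
    rw [← hTp]
    have : 0 ≤ T * D * T ^ (p - 1) := by positivity
    nlinarith
  have h3 : B / T = B * D ^ (1 / (p + 2)) := by rw [← hTi, mul_one_div]
  have h4 : 0 ≤ D ^ (1 / (p + 2)) := by positivity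
  have h5 := mul_le_mul_of_nonneg_left h2 hA
  rw [h3] at h1
  linarith

/-- `M` has no assumed sign; `ENNReal.ofReal` truncates it at zero, whence `max M 0`. -/
lemma real_Iic_sub_le_of_pdf_le {Ω : Type*} [MeasurableSpace Ω] {X : Ω → ℝ} {P : Measure Ω}
    [IsProbabilityMeasure P] {M : ℝ} (hpdf : HasPDF X P volume)
    (hM : ∀ᵐ x ∂(volume : Measure ℝ), pdf X P volume x ≤ ENNReal.ofReal M) {x y : ℝ}
    (hxy : x ≤ y) :
    (P.map X).real (Set.Iic y) - (P.map X).real (Set.Iic x) ≤ max M 0 * (y - x) := by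
  have : IsProbabilityMeasure (P.map X) :=
    Measure.isProbabilityMeasure_map (HasPDF.aemeasurable X P volume)
  have h1 : (P.map X).real (Set.Iic y) ≤
      (P.map X).real (Set.Iic x) + (P.map X).real (Set.Ioc x y) := by
    rw [← Set.Iic_union_Ioc_eq_Iic hxy]
    exact measureReal_union_le _ _
  have h2 : (P.map X).real (Set.Ioc x y) ≤ max M 0 * (y - x) := by
    rw [Measure.real]
    refine ENNReal.toReal_le_of_le_ofReal
      (mul_nonneg (le_max_right _ _) (sub_nonneg.2 hxy)) ?_
    rw [map_eq_setLIntegral_pdf X P volume measurableSet_Ioc]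
    calc _ ≤ ∫⁻ _ in Set.Ioc x y, ENNReal.ofReal M := lintegral_mono_ae (ae_restrict_of_ae hM)
      _ = ENNReal.ofReal (max M 0 * (y - x)) := by
        rw [setLIntegral_const, Real.volume_Ioc, ENNReal.ofReal_mul (le_max_right _ _),
          ENNReal.ofReal_max]
        simp
  linarith

lemma real_setOf_le_eq {Ω : Type*} [MeasurableSpace Ω] {X : Ω → ℝ} {P : Measure Ω}
    (hX : AEMeasurable X P) (x : ℝ) : P.real {ω | X ω ≤ x} = (P.map X).real (Set.Iic x) := by
  rw [Measure.real, Measure.real, Measure.map_apply_of_aemeasurable hX measurableSet_Iic]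
  rfl

end InfDiv

open InfDiv in
theorem theorem4p1 (p C M : ℝ) (hp : 1 ≤ p) (hC : 0 < C) :
    ∃ C' : ℝ, 0 < C' ∧
      ∀ {Ω : ℕ → Type*} [∀ n, MeasurableSpace (Ω n)]
        {Ωinf : Type*} [MeasurableSpace Ωinf] {Ω' : Type*} [MeasurableSpace Ω']
        (P : ∀ n, Measure (Ω n)) [∀ n, IsProbabilityMeasure (P n)]
        (Pinf : Measure Ωinf) [IsProbabilityMeasure Pinf]
        (Q : Measure Ω') [IsProbabilityMeasure Q]
        (X : ∀ n, Ω n → ℝ) (Xinf : Ωinf → ℝ)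
        (b : ℕ → ℝ) (ν : ℕ → Measure ℝ) (binf : ℝ) (νinf : Measure ℝ)
        (Ypos Yneg : ℕ → Ω' → ℝ) (YinfPos YinfNeg : Ω' → ℝ),
        -- infinitely divisible laws without Gaussian component, nondegenerate
        (∀ n, InfDiv.IsID (X n) (P n) (b n) 0 (ν n)) →
        InfDiv.IsID Xinf Pinf binf 0 νinf →
        (∀ n, InfDiv.Nondegenerate (X n) (P n)) →
        InfDiv.Nondegenerate Xinf Pinf →
        -- convergence in law
        TendstoInDistribution X atTop Xinf P Pinf →
        -- finite means, and `∫_{[-1,1]} |u| ν(du) < ∞`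
        (∀ n, Integrable (X n) (P n)) →
        Integrable Xinf Pinf →
        (∀ n, IntegrableOn (fun u : ℝ => |u|) (Set.Icc (-1) 1) (ν n)) →
        IntegrableOn (fun u : ℝ => |u|) (Set.Icc (-1) 1) νinf →
        -- generalized Dawson bound
        (∀ t : ℝ, ‖charFun (Pinf.map Xinf) t‖ *
          ∫ s in (0 : ℝ)..|t|, 1 / ‖charFun (Pinf.map Xinf) s‖ ≤ C * |t| ^ p) →
        -- the limit law is absolutely continuous with a density bounded by `M`
        HasPDF Xinf Pinf volume →
        (∀ᵐ x ∂(volume : Measure ℝ), pdf Xinf Pinf volume x ≤ ENNReal.ofReal M) →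
        -- the size-bias variables, with an arbitrary joint law; no condition when a mass vanishes
        (∀ n, InfDiv.massPos (b n) (ν n) ≠ 0 →
          HasLaw (Ypos n) (InfDiv.sizeBiasPos (b n) (ν n)) Q) →
        (∀ n, InfDiv.massNeg (b n) (ν n) ≠ 0 →
          HasLaw (Yneg n) (InfDiv.sizeBiasNeg (b n) (ν n)) Q) →
        (InfDiv.massPos binf νinf ≠ 0 →
          HasLaw YinfPos (InfDiv.sizeBiasPos binf νinf) Q) →
        (InfDiv.massNeg binf νinf ≠ 0 →
          HasLaw YinfNeg (InfDiv.sizeBiasNeg binf νinf) Q) →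
        ∀ n, ENNReal.ofReal (InfDiv.kolmogorovDist (X n) (P n) Xinf Pinf) ≤
          ENNReal.ofReal C' *
            (ENNReal.ofReal |InfDiv.massPos (b n) (ν n) - InfDiv.massPos binf νinf|
              + ENNReal.ofReal |InfDiv.massNeg (b n) (ν n) - InfDiv.massNeg binf νinf|
              + ENNReal.ofReal (InfDiv.massPos binf νinf)
                  * InfDiv.meanAbsDiff Q (Ypos n) YinfPos
              + ENNReal.ofReal (InfDiv.massNeg binf νinf)
                  * InfDiv.meanAbsDiff Q (Yneg n) YinfNeg) ^ (1 / (p + 2)) := by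
  obtain ⟨A, B, hA, hB, hess⟩ := esseen_smoothing
  have hBM : 0 ≤ B * max M 0 := mul_nonneg hB.le (le_max_right _ _)
  have hC' : 0 < 2 * (A * C) + B * max M 0 + 1 := by positivity
  refine ⟨2 * (A * C) + B * max M 0 + 1, hC', ?_⟩
  intro Ω _ Ωinf _ Ω' _ P _ Pinf _ Q _ X Xinf b ν binf νinf Ypos Yneg YinfPos YinfNeg hX hXinf
    _ _ _ hXi hXinfi hs hsinf hdawson hpdf hM hYp hYn hYip hYin n
  set Rp := ENNReal.ofReal (massPos binf νinf) * meanAbsDiff Q (Ypos n) YinfPos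
  set Rn := ENNReal.ofReal (massNeg binf νinf) * meanAbsDiff Q (Yneg n) YinfNeg
  have hq : 0 < 1 / (p + 2) := by positivity
  rcases eq_or_ne (ENNReal.ofReal |massPos (b n) (ν n) - massPos binf νinf|
      + ENNReal.ofReal |massNeg (b n) (ν n) - massNeg binf νinf| + Rp + Rn) ⊤ with htop | htop
  -- An infinite `Δ` makes the right side infinite because `C' > 0` and the exponent is positive.
  · rw [htop, ENNReal.top_rpow_of_pos hq, ENNReal.mul_top (ENNReal.ofReal_pos.2 hC').ne']
    exact le_top
  have hRp : Rp ≠ ⊤ := (ENNReal.add_ne_top.1 (ENNReal.add_ne_top.1 htop).1).2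
  have hRn : Rn ≠ ⊤ := (ENNReal.add_ne_top.1 htop).2
  set D := |massPos (b n) (ν n) - massPos binf νinf| + |massNeg (b n) (ν n) - massNeg binf νinf|
    + Rp.toReal + Rn.toReal with hD_def
  have hD : 0 ≤ D := by positivity
  have hΔ : ENNReal.ofReal |massPos (b n) (ν n) - massPos binf νinf|
      + ENNReal.ofReal |massNeg (b n) (ν n) - massNeg binf νinf| + Rp + Rn = ENNReal.ofReal D := by
    rw [hD_def, ENNReal.ofReal_add (by positivity) (by positivity),
      ENNReal.ofReal_add (by positivity) (by positivity),
      ENNReal.ofReal_add (by positivity) (by positivity), ENNReal.ofReal_toReal hRp,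
      ENNReal.ofReal_toReal hRn]
  rw [hΔ, ENNReal.ofReal_rpow_of_nonneg hD hq.le, ← ENNReal.ofReal_mul hC'.le]
  refine ENNReal.ofReal_le_ofReal ?_
  have hprob : IsProbabilityMeasure ((P n).map (X n)) :=
    Measure.isProbabilityMeasure_map (hX n).1
  have hprobinf : IsProbabilityMeasure (Pinf.map Xinf) :=
    Measure.isProbabilityMeasure_map hXinf.1
  have hν := (hX n).integrable_levyMeasure (hs n) (hXi n)
  have hνinf := hXinf.integrable_levyMeasure hsinf hXinfi
  have := isFiniteMeasure_biasPos hν (b n)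
  have := isFiniteMeasure_biasNeg hν (b n)
  have := isFiniteMeasure_biasPos hνinf binf
  have := isFiniteMeasure_biasNeg hνinf binf
  have hchar : ∀ t, 0 < t → ‖charFun ((P n).map (X n)) t - charFun (Pinf.map Xinf) t‖ ≤
      D * (1 + t) * (C * t ^ p) := by
    intro t ht
    have h1 := norm_sub_le_of_hasDerivAt hD (fun s => (hX n).hasDerivAt_charFun hν s)
      (fun s => hXinf.hasDerivAt_charFun hνinf s) hXinf.charFun_ne_zero
      (by simp [charFun_zero]) (fun s => norm_charFun_le_one s) (fun s hs0 => ?_) ht.le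
    · refine h1.trans (mul_le_mul_of_nonneg_left ?_ (by positivity))
      simpa only [abs_of_pos ht] using hdawson t
    -- `sizeBiasPos` is by definition `biasPos` divided by its mass, so the law hypotheses apply as
    -- they stand; likewise for the negative part.
    · have hpos := norm_charFun_sub_charFun_le (biasPos_real_univ hν (b n))
        (biasPos_real_univ hνinf binf) (hYp n) hYip hRp s
      have hneg := norm_charFun_sub_charFun_le (biasNeg_real_univ hν (b n))
        (biasNeg_real_univ hνinf binf) (hYn n) hYin hRn s
      rw [abs_of_nonneg hs0] at hpos hneg
      rw [sub_sub_sub_comm]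
      refine (norm_sub_le _ _).trans ((add_le_add hpos hneg).trans ?_)
      have e1 := mul_nonneg hs0 (abs_nonneg (massPos (b n) (ν n) - massPos binf νinf))
      have e2 := mul_nonneg hs0 (abs_nonneg (massNeg (b n) (ν n) - massNeg binf νinf))
      have e3 : 0 ≤ Rp.toReal := ENNReal.toReal_nonneg
      have e4 : 0 ≤ Rn.toReal := ENNReal.toReal_nonneg
      rw [hD_def]
      linarith
  refine le_mul_rpow_of_forall_pos (by positivity) hBM hp ?_ hD fun T hT => ?_
  · refine ciSup_le fun x => abs_le.2 ⟨?_, ?_⟩ <;>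
      linarith [measureReal_nonneg (μ := P n) (s := {ω | X n ω ≤ x}),
        measureReal_nonneg (μ := Pinf) (s := {ω | Xinf ω ≤ x}),
        measureReal_le_one (μ := P n) (s := {ω | X n ω ≤ x}),
        measureReal_le_one (μ := Pinf) (s := {ω | Xinf ω ≤ x})]
  · refine ciSup_le fun x => ?_
    rw [real_setOf_le_eq (hX n).1, real_setOf_le_eq hXinf.1]
    -- `W` is the bound `hchar` divided by `t` and taken at `t = T`; it is nondecreasing in `t`
    -- because `p ≥ 1`.
    refine (hess _ _ ((integrable_map_measure aestronglyMeasurable_id (hX n).1).2 (hXi n))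
      ((integrable_map_measure aestronglyMeasurable_id hXinf.1).2 hXinfi) (max M 0) T
      (C * (D * (1 + T) * T ^ (p - 1))) (le_max_right _ _) hT (by positivity)
      (fun x y hxy => real_Iic_sub_le_of_pdf_le hpdf hM hxy) (fun t ht htT => ?_) x).trans
      (le_of_eq (by ring))
    refine (hchar t ht).trans ?_
    have e1 : t ^ p = t * t ^ (p - 1) := by
      rw [← Real.rpow_one_add' ht.le (by linarith)]
      congr 1
      ring
    have e2 : t ^ (p - 1) ≤ T ^ (p - 1) := Real.rpow_le_rpow ht.le htT (by linarith)
    calc D * (1 + t) * (C * t ^ p) = t * (C * (D * ((1 + t) * t ^ (p - 1)))) := by rw [e1]; ring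
      _ ≤ t * (C * (D * ((1 + T) * T ^ (p - 1)))) := by gcongr
      _ = _ := by ring
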